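/- Cut-Set Outer Bound. Let $\mathcal{T}$ be a finite tree with nodes $v_0,\dots,v_n$ and root (sink) $v_0$. For $i\neq 0$ let $v_{\mathrm{PN}(i)}$ be the parent of $v_i$, i.e. its neighbour on the path to $v_0$, and let $\mathcal{S}_i$ be the set that consists of $v_i$ and all its descendants. Let $N\ge 1$, let the nodes observe independent vectors $\mathbf{x}_i\sim\mathcal{N}(\mathbf{0}_N,\mathbf{I}_N)$, and let $w_i$ be real weights. For a set $\mathcal{S}$ of nodes put $\mathbf{y}_{\mathcal{S}}=\sum_{v_j\in\mathcal{S}}w_j\mathbf{x}_j$ and $\sigma_{\mathcal{S}}^2=\sum_{v_j\in\mathcal{S}}w_j^2$. Besides its observation, each node may generate random data; the random data of all nodes together are independent of the observations. A feasible oblivious distributed computation scheme consists of a finite number $T$ of time slots, and, for each slot $t$, of a transmitting node $v(t)$, an edge $e(t)$ at $v(t)$, a measurable mapping $f_t$ and a measurable encoding mapping $g_t$ with values in the binary sequences of a finite length $\ell_t$. All of these are fixed in advance and do not depend on the data. In slot $t$ the node $v(t)$ applies $f_t$ to its observation, its random data and the messages that it received in earlier slots, and sends the $\ell_t$ bits $g_t(f_t)$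 along $e(t)$. The sum rate is $R=\frac1N\sum_{t=1}^T\ell_t$. Let $I_j$ be all the information available at $v_j$ at the end: its observation, its random data and all the messages that it received. For $i\neq0$ let $$D_i^{\mathrm{Rx}}=\frac1N\,\mathbb{E}\Big[\big\|\mathbf{y}_{\mathcal{S}_i}-\mathbb{E}[\mathbf{y}_{\mathcal{S}_i}\mid I_{\mathrm{PN}(i)}]\big\|_2^2\Big]$$ be the MMSE distortion with which the parent of $v_i$ estimates $\mathbf{y}_{\mathcal{S}_i}$. Then for every feasible oblivious distributed computation scheme $D_i^{\mathrm{Rx}}>0$ for every $i\ne 0$ with $\sigma_{\mathcal{S}_i}^2>0$, and $$R\;\ge\;\frac12\sum_{i=1}^n\log_2\frac{\sigma_{\mathcal{S}_i}^2}{D_i^{\mathrm{Rx}}},$$ where terms with $\sigma_{\mathcal{S}_i}^2=0$ (for which also $D_i^{\mathrm{Rx}}=0$) are read as $0$. -/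

import Mathlib

open MeasureTheory ProbabilityTheory

namespace TreeAggregation

/-! ### Rooted trees -/

section Tree

variable {V : Type*} {G : SimpleGraph V}

/-- The unique path from `i` to `j` in a tree. -/
noncomputable def treePath (hG : G.IsTree) (i j : V) : G.Walk i j :=
  (hG.existsUnique_path i j).choose

/-- The parent of `i` in the tree rooted at `r`: the neighbour of `i` on the path from `i` to `r`
(only used for `i ≠ r`). -/
noncomputable def parent (hG : G.IsTree) (r i : V) : V :=
  (treePath hG i r).snd

open Classical in
/-- The set that consists of `i` and all its descendants in the tree rooted at `r`: the nodes `j`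
such that `i` lies on the path from `j` to `r`. -/
noncomputable def subtree [Fintype V] (hG : G.IsTree) (r i : V) : Finset V :=
  {j : V | i ∈ (treePath hG j r).support}

end Tree

/-! ### Distributed computation schemes -/

/-- A feasible oblivious distributed computation scheme on the network `G`, with blocklength `N` and
with random data generated at node `v` taking values in `𝓤 v`. The number `T` of time slots, the
transmitting nodes, the edges and the numbers of bits do not depend on the inputs. In slot `t` the
node `sender t` applies the real (vector-valued) mapping `f t` to its own observation, its own
random data and the messages that it received in earlier slots, encodes the result by `g t` into a
binary sequence of length `len t`, and sends that sequence to its neighbour `receiver t`. -/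
structure Scheme {V : Type*} (G : SimpleGraph V) (N : ℕ) (𝓤 : V → Type*)
    [∀ v, MeasurableSpace (𝓤 v)] where
  T : ℕ
  sender : Fin T → V
  receiver : Fin T → V
  adj : ∀ t, G.Adj (sender t) (receiver t)
  dim : Fin T → ℕ
  len : Fin T → ℕ
  f : ∀ t : Fin T,
    EuclideanSpace ℝ (Fin N) × 𝓤 (sender t) ×
      (∀ s : {s : Fin T // s < t ∧ receiver s = sender t}, Fin (len s.1) → Bool) →
    (Fin (dim t) → ℝ)
  measurable_f : ∀ t, Measurable (f t)
  g : ∀ t : Fin T, (Fin (dim t) → ℝ) → (Fin (len t) → Bool)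
  measurable_g : ∀ t, Measurable (g t)

namespace Scheme

variable {V : Type*} {G : SimpleGraph V} {N : ℕ} {𝓤 : V → Type*} [∀ v, MeasurableSpace (𝓤 v)]

/-- The bits transmitted in slot `t` when the observations are `x` and the random data are `u`. -/
def message (P : Scheme G N 𝓤) (x : V → EuclideanSpace ℝ (Fin N)) (u : ∀ v, 𝓤 v)
    (t : Fin P.T) : Fin (P.len t) → Bool :=
  P.g t (P.f t (x (P.sender t), u (P.sender t), fun s => P.message x u s.1))
termination_by t
decreasing_by exact s.2.1

/-- All the information available at node `v` at the end: its observation, its random data, and all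
the messages that it received. -/
def info (P : Scheme G N 𝓤) (v : V) (x : V → EuclideanSpace ℝ (Fin N)) (u : ∀ v, 𝓤 v) :
    EuclideanSpace ℝ (Fin N) × 𝓤 v ×
      (∀ s : {s : Fin P.T // P.receiver s = v}, Fin (P.len s.1) → Bool) :=
  (x v, u v, fun s => P.message x u s.1)

/-- The sum rate: the total number of transmitted bits, divided by the blocklength. -/
noncomputable def sumRate (P : Scheme G N 𝓤) : ℝ :=
  (∑ t, (P.len t : ℝ)) / N

end Scheme

/-! ### Partial sums and distortions -/

section Distortion

variable {V : Type*} {G : SimpleGraph V} {N : ℕ} {𝓤 : V → Type*} [∀ v, MeasurableSpace (𝓤 v)]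
  {Ω : Type*} [MeasurableSpace Ω]

/-- The weighted partial sum over `S` of the observations. -/
noncomputable def partialSum (w : V → ℝ) (X : V → Ω → EuclideanSpace ℝ (Fin N)) (S : Finset V) :
    Ω → EuclideanSpace ℝ (Fin N) :=
  fun ω => ∑ j ∈ S, w j • X j ω

/-- The variance of each entry of the partial sum over `S`. -/
def sumVar (w : V → ℝ) (S : Finset V) : ℝ :=
  ∑ j ∈ S, w j ^ 2

/-- The MMSE estimate of the partial sum over `S` at node `v`: its conditional expectation given all
the information available at `v` at the end. -/
noncomputable def mmseEstimate (μ : Measure Ω) (w : V → ℝ)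
    (X : V → Ω → EuclideanSpace ℝ (Fin N)) (U : ∀ v, Ω → 𝓤 v) (P : Scheme G N 𝓤)
    (S : Finset V) (v : V) : Ω → EuclideanSpace ℝ (Fin N) :=
  μ[partialSum w X S |
    MeasurableSpace.comap (fun ω => P.info v (fun j => X j ω) (fun j => U j ω)) inferInstance]

/-- The normalized mean-square error with which the parent of `i` estimates the partial sum over
the subtree of `i`. -/
noncomputable def distRx [Fintype V] (μ : Measure Ω) (hG : G.IsTree) (r : V) (w : V → ℝ)
    (X : V → Ω → EuclideanSpace ℝ (Fin N)) (U : ∀ v, Ω → 𝓤 v) (P : Scheme G N 𝓤) (i : V) : ℝ :=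
  (1 / N : ℝ) * ∫ ω, ‖partialSum w X (subtree hG r i) ω -
    mmseEstimate μ w X U P (subtree hG r i) (parent hG r i) ω‖ ^ 2 ∂μ

end Distortion

end TreeAggregation

open TreeAggregation

namespace TreeAggregation

/-! ### Cuts of the rooted tree. -/

section Tree

variable {V : Type*} {G : SimpleGraph V} (hG : G.IsTree)

/-! Cut the tree at the edge from `i` to its parent. With S the subtree of `i`, the parent's
information is a function of the bits sent up this edge, the observations outside S and the random
data (`Scheme.infoGiven_eq_info`). The partial sum over S is σA with A standard Gaussian,
independent of these observations and random data (`indepFun_partialSum`). So the MMSE estimate is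
c(B, Z) with Z independent of A and B taking at most 2^k values, k being the number of uplink bits.

No mutual information is needed. The expectation of exp(-‖σA - c(b, Z)‖²/(2t) + ‖A‖²/2) is (√t/σ)^N
for every fixed b. Summing over b bounds the exponential moment for the actual B, and Jensen's
inequality turns this into a bound on the mean-square error (`le_log_card_of_indepFun`). The choice
t = D gives (N/2) log(σ²/D) ≤ k log 2 (`distortion_bound`). Uplinks of distinct nodes use distinct
slots, so the bounds add up. -/

lemma isPath_treePath (i j : V) : (treePath hG i j).IsPath :=
  (hG.existsUnique_path i j).choose_spec.1

lemma eq_treePath {i j : V} {q : G.Walk i j} (hq : q.IsPath) : q = treePath hG i j :=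
  (hG.existsUnique_path i j).choose_spec.2 q hq

variable [Fintype V]

lemma mem_subtree {r i j : V} : j ∈ subtree hG r i ↔ i ∈ (treePath hG j r).support := by
  simp [subtree]

/-- The only edge that leaves the subtree of `i` joins `i` to its parent. -/
lemma eq_parent_of_adj_of_mem_subtree {r i a b : V} (hab : G.Adj a b) (ha : a ∈ subtree hG r i)
    (hb : b ∉ subtree hG r i) : a = i ∧ b = parent hG r i := by
  classical
  rw [mem_subtree] at ha hb
  -- If `a` is on the path from `b`, then the path from `a` is its final segment, so `i` is also on
  -- the path from `b`. Otherwise the path from `a` is `a` followed by the path from `b`, which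
  -- misses `i`; hence `i = a`.
  by_cases h : a ∈ (treePath hG b r).support
  · have hd := eq_treePath hG ((isPath_treePath hG b r).dropUntil h)
    rw [← hd] at ha
    exact absurd ((treePath hG b r).support_dropUntil_subset_support h ha) hb
  · have hc := eq_treePath hG ((isPath_treePath hG b r).cons (h := hab) h)
    have hai : a = i := by
      rw [← hc, SimpleGraph.Walk.support_cons, List.mem_cons] at ha
      exact (ha.resolve_right hb).symm
    subst hai
    exact ⟨rfl, by rw [parent, ← hc, SimpleGraph.Walk.snd_cons]⟩

lemma parent_notMem_subtree {r i : V} (hi : i ≠ r) : parent hG r i ∉ subtree hG r i := by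
  rw [mem_subtree]
  have hp := isPath_treePath hG i r
  have hnil : ¬ (treePath hG i r).Nil := SimpleGraph.Walk.not_nil_of_ne hi
  have ht := eq_treePath hG hp.tail
  change (treePath hG i r).tail = treePath hG (parent hG r i) r at ht
  rw [← ht]
  rw [← SimpleGraph.Walk.cons_tail_eq _ hnil, SimpleGraph.Walk.cons_isPath_iff] at hp
  exact hp.2

end Tree

/-! ### Simulating the scheme outside a cut. -/

namespace Scheme

variable {V : Type*} {G : SimpleGraph V} {N : ℕ} {𝓤 : V → Type*} [∀ v, MeasurableSpace (𝓤 v)]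

open Classical in
/-- The messages computed by the nodes when the messages of the slots in `C` are replaced by the
prescribed bits `b`. -/
noncomputable def messageGiven (P : Scheme G N 𝓤) (C : Fin P.T → Prop)
    (b : ∀ t : {t // C t}, Fin (P.len t.1) → Bool)
    (x : V → EuclideanSpace ℝ (Fin N)) (u : ∀ v, 𝓤 v) (t : Fin P.T) : Fin (P.len t) → Bool :=
  if h : C t then b ⟨t, h⟩ else
    P.g t (P.f t (x (P.sender t), u (P.sender t), fun s => P.messageGiven C b x u s.1))
termination_by t
decreasing_by exact s.2.1

variable (P : Scheme G N 𝓤)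

lemma measurable_messageGiven (C : Fin P.T → Prop)
    (b : ∀ t : {t // C t}, Fin (P.len t.1) → Bool) (t : Fin P.T) :
    Measurable fun z : (V → EuclideanSpace ℝ (Fin N)) × (∀ v, 𝓤 v) =>
      P.messageGiven C b z.1 z.2 t := by
  induction t using WellFoundedLT.induction with
  | ind t ih =>
    by_cases h : C t
    · have : (fun z : (V → EuclideanSpace ℝ (Fin N)) × (∀ v, 𝓤 v) =>
          P.messageGiven C b z.1 z.2 t) = fun _ => b ⟨t, h⟩ := by
        funext z; rw [messageGiven, dif_pos h]
      rw [this]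
      exact measurable_const
    · have : (fun z : (V → EuclideanSpace ℝ (Fin N)) × (∀ v, 𝓤 v) =>
          P.messageGiven C b z.1 z.2 t) = fun z => P.g t (P.f t (z.1 (P.sender t),
            z.2 (P.sender t), fun s => P.messageGiven C b z.1 z.2 s.1)) := by
        funext z; rw [messageGiven, dif_neg h]
      rw [this]
      refine (P.measurable_g t).comp ((P.measurable_f t).comp ?_)
      refine Measurable.prodMk (by fun_prop) (Measurable.prodMk (by fun_prop) ?_)
      exact measurable_pi_lambda _ fun s => ih s.1 s.2.1

/-- If every slot that leads from `S` to its complement belongs to `C`, then the messages sent by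
the nodes outside `S` are determined by the observations outside `S`, the random data, and the
messages of the slots in `C`. -/
lemma messageGiven_eq_message {C : Fin P.T → Prop} {S : Finset V}
    (hC : ∀ t, P.sender t ∈ S → P.receiver t ∉ S → C t)
    {x x' : V → EuclideanSpace ℝ (Fin N)} (u : ∀ v, 𝓤 v) (hx : ∀ v ∉ S, x' v = x v)
    (t : Fin P.T) (ht : P.receiver t ∉ S ∨ P.sender t ∉ S) :
    P.messageGiven C (fun t => P.message x u t.1) x' u t = P.message x u t := by
  induction t using WellFoundedLT.induction with
  | ind t ih =>
    rw [messageGiven]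
    split_ifs with h
    · rfl
    · have hs : P.sender t ∉ S := fun hs => h (hC t hs (ht.resolve_right (not_not_intro hs)))
      rw [message, hx _ hs]
      congr 4
      funext s
      exact ih s.1 s.2.1 (Or.inl (by rwa [s.2.2]))

/-- The information available at node `v`, computed from prescribed messages for the slots
in `C`. -/
noncomputable def infoGiven (C : Fin P.T → Prop) (v : V)
    (b : ∀ t : {t // C t}, Fin (P.len t.1) → Bool)
    (x : V → EuclideanSpace ℝ (Fin N)) (u : ∀ v, 𝓤 v) :
    EuclideanSpace ℝ (Fin N) × 𝓤 v ×
      (∀ s : {s : Fin P.T // P.receiver s = v}, Fin (P.len s.1) → Bool) :=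
  (x v, u v, fun s => P.messageGiven C b x u s.1)

lemma measurable_infoGiven (C : Fin P.T → Prop) (v : V)
    (b : ∀ t : {t // C t}, Fin (P.len t.1) → Bool) :
    Measurable fun z : (V → EuclideanSpace ℝ (Fin N)) × (∀ v, 𝓤 v) =>
      P.infoGiven C v b z.1 z.2 := by
  unfold infoGiven
  exact Measurable.prodMk (by fun_prop) (Measurable.prodMk (by fun_prop)
    (measurable_pi_lambda _ fun s => P.measurable_messageGiven C b s.1))

lemma infoGiven_eq_info {C : Fin P.T → Prop} {S : Finset V}
    (hC : ∀ t, P.sender t ∈ S → P.receiver t ∉ S → C t)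
    {x x' : V → EuclideanSpace ℝ (Fin N)} (u : ∀ v, 𝓤 v) (hx : ∀ v ∉ S, x' v = x v)
    {v : V} (hv : v ∉ S) :
    P.infoGiven C v (fun t => P.message x u t.1) x' u = P.info v x u := by
  unfold infoGiven info
  rw [hx v hv]
  congr 2
  funext s
  exact P.messageGiven_eq_message hC u hx s.1 (Or.inl (by rwa [s.2]))

end Scheme

/-! ### Gaussian integrals and the distortion bound. -/

section Gaussian

variable {N : ℕ}

lemma integral_sq_gaussianReal_zero_one : ∫ x, x ^ 2 ∂(gaussianReal 0 1) = 1 := by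
  have h := variance_fun_id_gaussianReal (μ := 0) (v := 1)
  rw [variance_of_integral_eq_zero (by fun_prop) (by simp)] at h
  simpa using h

lemma integral_norm_sq_stdGaussian :
    ∫ x, ‖x‖ ^ 2 ∂(stdGaussian (EuclideanSpace ℝ (Fin N))) = N := by
  rw [← map_pi_eq_stdGaussian, integral_map (by fun_prop) (by fun_prop)]
  simp_rw [EuclideanSpace.real_norm_sq_eq]
  have hint : Integrable (fun x : ℝ => x ^ 2) (gaussianReal 0 1) :=
    (memLp_id_gaussianReal (μ := 0) (v := 1) 2).integrable_sq
  rw [integral_finsetSum _ fun i _ =>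
    integrable_comp_eval (μ := fun _ : Fin N => gaussianReal 0 1) (i := i) hint]
  simp_rw [integral_comp_eval (μ := fun _ : Fin N => gaussianReal 0 1)
    (f := fun x : ℝ => x ^ 2) (by fun_prop), integral_sq_gaussianReal_zero_one]
  simp

lemma memLp_id_stdGaussian :
    MemLp (fun x => x) 2 (stdGaussian (EuclideanSpace ℝ (Fin N))) :=
  IsGaussian.memLp_two_id

/-- The Gaussian integral behind the distortion bound, in dimension one. -/
lemma integral_exp_neg_sq_sub_gaussianReal {σ t : ℝ} (hσ : 0 < σ) (ht : 0 < t) (c : ℝ) :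
    ∫ x, Real.exp (-(σ * x - c) ^ 2 / (2 * t) + x ^ 2 / 2) ∂(gaussianReal 0 1) =
      √t / σ := by
  rw [integral_gaussianReal_eq_integral_smul (by norm_num)]
  -- The term `x ^ 2 / 2` cancels the Gaussian density, leaving a Lebesgue integral that is
  -- invariant under translation.
  have h : ∀ x : ℝ, gaussianPDFReal 0 1 x •
      Real.exp (-(σ * x - c) ^ 2 / (2 * t) + x ^ 2 / 2) =
      (√(2 * Real.pi))⁻¹ * Real.exp (-(σ ^ 2 / (2 * t)) * (x - c / σ) ^ 2) := by
    intro x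
    rw [gaussianPDFReal_def, smul_eq_mul, mul_assoc, ← Real.exp_add]
    simp only [NNReal.coe_one, mul_one, sub_zero]
    congr 2
    field_simp
    ring
  simp_rw [h]
  rw [integral_const_mul, integral_sub_right_eq_self
    (fun x => Real.exp (-(σ ^ 2 / (2 * t)) * x ^ 2)), integral_gaussian]
  have h2 : Real.pi / (σ ^ 2 / (2 * t)) = (2 * Real.pi) * (√t / σ) ^ 2 := by
    rw [div_pow, Real.sq_sqrt ht.le]
    field_simp
  rw [h2, Real.sqrt_mul (x := 2 * Real.pi) (by positivity), Real.sqrt_sq (by positivity),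
    ← mul_assoc, inv_mul_cancel₀ (by positivity), one_mul]

/-- The integrand factors over coordinates. That the value is free of `c` is what later allows an
arbitrary estimator. -/
lemma integral_exp_neg_norm_sub_sq_stdGaussian {σ t : ℝ} (hσ : 0 < σ) (ht : 0 < t)
    (c : EuclideanSpace ℝ (Fin N)) :
    ∫ x, Real.exp (-‖σ • x - c‖ ^ 2 / (2 * t) + ‖x‖ ^ 2 / 2)
      ∂(stdGaussian (EuclideanSpace ℝ (Fin N))) = (√t / σ) ^ N := by
  rw [← map_pi_eq_stdGaussian, integral_map (by fun_prop) (by fun_prop)]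
  have h : ∀ x : Fin N → ℝ, Real.exp (-‖σ • WithLp.toLp 2 x - c‖ ^ 2 / (2 * t) +
      ‖WithLp.toLp 2 x‖ ^ 2 / 2) =
      ∏ k, Real.exp (-(σ * x k - c k) ^ 2 / (2 * t) + x k ^ 2 / 2) := by
    intro x
    rw [← Real.exp_sum, EuclideanSpace.real_norm_sq_eq, EuclideanSpace.real_norm_sq_eq]
    simp [Finset.sum_add_distrib, Finset.sum_div, neg_div]
  simp_rw [h]
  rw [integral_fintype_prod_eq_prod
    (fun k x => Real.exp (-(σ * x - c k) ^ 2 / (2 * t) + x ^ 2 / 2))]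
  simp [integral_exp_neg_sq_sub_gaussianReal hσ ht, div_pow]

lemma lintegral_exp_neg_norm_sub_sq_stdGaussian {σ t : ℝ} (hσ : 0 < σ) (ht : 0 < t)
    (c : EuclideanSpace ℝ (Fin N)) :
    ∫⁻ x, ENNReal.ofReal (Real.exp (-‖σ • x - c‖ ^ 2 / (2 * t) + ‖x‖ ^ 2 / 2))
      ∂(stdGaussian (EuclideanSpace ℝ (Fin N))) = ENNReal.ofReal ((√t / σ) ^ N) := by
  have h := integral_exp_neg_norm_sub_sq_stdGaussian hσ ht c
  rw [← ofReal_integral_eq_lintegral_ofReal _ (ae_of_all _ fun _ => (Real.exp_pos _).le), h]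
  -- The integral of a nonintegrable function is 0 by convention, so a positive value proves
  -- integrability.
  refine not_imp_comm.1 integral_undef ?_
  rw [h]
  positivity

variable {Ω : Type*} [MeasurableSpace Ω] {μ : Measure Ω} [IsProbabilityMeasure μ]

/-- A lower bound on the mean-square error of an estimate of a Gaussian vector that, apart from
independent side information `Z`, depends on finitely many values only. -/
lemma le_log_card_of_indepFun {ζ β : Type*} [MeasurableSpace ζ] [Fintype β]
    {A : Ω → EuclideanSpace ℝ (Fin N)} {Z : Ω → ζ} {B : Ω → β}
    (hA : HasLaw A (stdGaussian (EuclideanSpace ℝ (Fin N))) μ) (hZ : Measurable Z)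
    (hAZ : IndepFun A Z μ) {c : β → ζ → EuclideanSpace ℝ (Fin N)} (hc : ∀ b, Measurable (c b))
    {σ t : ℝ} (hσ : 0 < σ) (ht : 0 < t)
    (hint : Integrable (fun ω => ‖σ • A ω - c (B ω) (Z ω)‖ ^ 2) μ) :
    N / 2 - (∫ ω, ‖σ • A ω - c (B ω) (Z ω)‖ ^ 2 ∂μ) / (2 * t) ≤
      Real.log (Fintype.card β) + N * Real.log (√t / σ) := by
  obtain ⟨ω₀⟩ : Nonempty Ω := nonempty_of_isProbabilityMeasure μ
  have hcard : 0 < Fintype.card β := Fintype.card_pos_iff.2 ⟨B ω₀⟩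
  set K : ℝ := Fintype.card β * (√t / σ) ^ N with hK
  have hKpos : 0 < K := by positivity
  set W : Ω → ℝ := fun ω =>
    -‖σ • A ω - c (B ω) (Z ω)‖ ^ 2 / (2 * t) + ‖A ω‖ ^ 2 / 2 with hW
  have hA2 : Integrable (fun ω => ‖A ω‖ ^ 2) μ := by
    have h := memLp_id_stdGaussian (N := N)
    rw [← hA.map_eq] at h
    exact (h.comp_of_map hA.aemeasurable).integrable_norm_pow two_ne_zero
  have hA2v : ∫ ω, ‖A ω‖ ^ 2 ∂μ = N := by
    rw [← integral_norm_sq_stdGaussian]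
    exact hA.integral_comp (f := fun x => ‖x‖ ^ 2) (by fun_prop)
  have hdint : Integrable (fun ω => -‖σ • A ω - c (B ω) (Z ω)‖ ^ 2 / (2 * t)) μ :=
    hint.neg.div_const _
  have hWint : Integrable W μ := hdint.add (hA2.div_const _)
  have hWval : ∫ ω, W ω ∂μ =
      N / 2 - (∫ ω, ‖σ • A ω - c (B ω) (Z ω)‖ ^ 2 ∂μ) / (2 * t) := by
    rw [hW, integral_add hdint (hA2.div_const _), integral_div, integral_div,
      integral_neg, hA2v]
    ring
  have hlin : ∫⁻ ω, ENNReal.ofReal (Real.exp (W ω)) ∂μ ≤ ENNReal.ofReal K := by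
    set F : β → EuclideanSpace ℝ (Fin N) × ζ → ENNReal := fun b p =>
      ENNReal.ofReal (Real.exp (-‖σ • p.1 - c b p.2‖ ^ 2 / (2 * t) + ‖p.1‖ ^ 2 / 2)) with hF
    have hFm : ∀ b, Measurable (F b) := fun b => by
      have h : Measurable fun p : EuclideanSpace ℝ (Fin N) × ζ => σ • p.1 - c b p.2 :=
        (measurable_fst.const_smul σ).sub ((hc b).comp measurable_snd)
      exact (((h.norm.pow_const 2).neg.div_const _).add
        ((measurable_fst.norm.pow_const 2).div_const _)).exp.ennreal_ofReal
    have hZl : HasLaw Z (μ.map Z) μ := ⟨hZ.aemeasurable, rfl⟩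
    have : IsProbabilityMeasure (μ.map Z) := Measure.isProbabilityMeasure_map hZ.aemeasurable
    have hlaw := hAZ.hasLaw_prod hA hZl
    calc ∫⁻ ω, ENNReal.ofReal (Real.exp (W ω)) ∂μ
        ≤ ∫⁻ ω, ∑ b, F b (A ω, Z ω) ∂μ := by
          -- `B` may depend on `A` in any way; bounding by the sum over all `b` removes this
          -- dependence at the cost of the factor `Fintype.card β`.
          refine lintegral_mono fun ω => ?_
          exact Finset.single_le_sum (f := fun b => F b (A ω, Z ω)) (fun _ _ => zero_le)
            (Finset.mem_univ (B ω))
      _ = ∑ b, ∫⁻ ω, F b (A ω, Z ω) ∂μ :=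
          lintegral_finsetSum' _ fun b _ =>
            (hFm b).comp_aemeasurable (hA.aemeasurable.prodMk hZ.aemeasurable)
      _ = ∑ _b : β, ENNReal.ofReal ((√t / σ) ^ N) := by
          refine Finset.sum_congr rfl fun b _ => ?_
          rw [hlaw.lintegral_comp (f := F b) (hFm b).aemeasurable,
            lintegral_prod_symm _ (hFm b).aemeasurable]
          simp [hF, lintegral_exp_neg_norm_sub_sq_stdGaussian hσ ht]
      _ = ENNReal.ofReal K := by
          rw [hK, ENNReal.ofReal_mul (by positivity)]
          simp
  have hexp : Integrable (fun ω => Real.exp (W ω)) μ := by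
    refine ⟨Real.continuous_exp.comp_aestronglyMeasurable hWint.1, ?_⟩
    rw [hasFiniteIntegral_iff_ofReal (ae_of_all _ fun _ => (Real.exp_pos _).le)]
    exact hlin.trans_lt ENNReal.ofReal_lt_top
  have hexpK : ∫ ω, Real.exp (W ω) ∂μ ≤ K := by
    rw [integral_eq_lintegral_of_nonneg_ae (ae_of_all _ fun _ => (Real.exp_pos _).le) hexp.1]
    exact ENNReal.toReal_le_of_le_ofReal hKpos.le hlin
  -- Jensen's inequality by way of the tangent line to exp at 0, evaluated at `W - log K`.
  have hmono : ∫ ω, (W ω + (1 - Real.log K)) ∂μ ≤ ∫ ω, Real.exp (W ω) / K ∂μ := by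
    refine integral_mono (hWint.add (integrable_const _)) (hexp.div_const _) fun ω => ?_
    have h1 := Real.add_one_le_exp (W ω - Real.log K)
    rw [Real.exp_sub, Real.exp_log hKpos] at h1
    simp only
    linarith
  rw [integral_add hWint (integrable_const _), integral_div, integral_const] at hmono
  simp only [probReal_univ, one_smul] at hmono
  have hdiv : (∫ ω, Real.exp (W ω) ∂μ) / K ≤ 1 := (div_le_one hKpos).2 hexpK
  have hlogK : Real.log K = Real.log (Fintype.card β) + N * Real.log (√t / σ) := by
    rw [hK, Real.log_mul (by positivity) (by positivity), Real.log_pow]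
  rw [← hWval, ← hlogK]
  linarith

/-- The Shannon lower bound for the estimate of a Gaussian vector that, apart from independent side
information `Z`, depends on finitely many values only. -/
lemma distortion_bound {ζ β : Type*} [MeasurableSpace ζ] [Fintype β] (hN : 0 < N)
    {A : Ω → EuclideanSpace ℝ (Fin N)} {Z : Ω → ζ} {B : Ω → β}
    (hA : HasLaw A (stdGaussian (EuclideanSpace ℝ (Fin N))) μ) (hZ : Measurable Z)
    (hAZ : IndepFun A Z μ) {c : β → ζ → EuclideanSpace ℝ (Fin N)} (hc : ∀ b, Measurable (c b))
    {σ : ℝ} (hσ : 0 < σ) {D : ℝ}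
    (hint : Integrable (fun ω => ‖σ • A ω - c (B ω) (Z ω)‖ ^ 2) μ)
    (hD : D = (1 / N : ℝ) * ∫ ω, ‖σ • A ω - c (B ω) (Z ω)‖ ^ 2 ∂μ) :
    0 < D ∧ N / 2 * Real.log (σ ^ 2 / D) ≤ Real.log (Fintype.card β) := by
  have hN' : (0 : ℝ) < N := by exact_mod_cast hN
  have key := fun (t : ℝ) (ht : 0 < t) => le_log_card_of_indepFun hA hZ hAZ hc hσ ht hint
  have hI : ∫ ω, ‖σ • A ω - c (B ω) (Z ω)‖ ^ 2 ∂μ = N * D := by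
    rw [hD]; field_simp
  rw [hI] at key
  have hD0 : 0 ≤ D := by
    rw [hD]
    have : 0 ≤ ∫ ω, ‖σ • A ω - c (B ω) (Z ω)‖ ^ 2 ∂μ := integral_nonneg fun _ => by positivity
    positivity
  have hlog : ∀ t : ℝ, 0 < t → Real.log (√t / σ) = Real.log t / 2 - Real.log σ := fun t ht => by
    rw [Real.log_div (by positivity) (by positivity), Real.log_sqrt ht.le]
  have hDpos : 0 < D := by
    refine lt_of_le_of_ne hD0 fun h0 => ?_
    set L : ℝ := Real.log (Fintype.card β) with hL
    -- With this `t` the right side of `key` is `L - L = 0`, while `D = 0` would make the left side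
    -- `N / 2`.
    have h := key (Real.exp (2 * (Real.log σ - L / N))) (Real.exp_pos _)
    rw [hlog _ (Real.exp_pos _), Real.log_exp, ← h0] at h
    have h2 : (N : ℝ) * (2 * (Real.log σ - L / N) / 2 - Real.log σ) = - L := by
      field_simp
      ring
    rw [h2] at h
    simp only [mul_zero, zero_div, sub_zero] at h
    linarith
  refine ⟨hDpos, ?_⟩
  -- `t = D` is the optimal choice in `key`.
  have h := key D hDpos
  rw [hlog D hDpos] at h
  rw [Real.log_div (by positivity) hDpos.ne', Real.log_pow]
  have h2 : (N : ℝ) * D / (2 * D) = N / 2 := by field_simp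
  rw [h2] at h
  push_cast
  linarith

/-- A weighted sum of independent standard Gaussian vectors, divided by its standard deviation, is
a standard Gaussian vector. -/
lemma hasLaw_inv_smul_sum {V : Type*} {w : V → ℝ} {S : Finset V} (hS : 0 < sumVar w S)
    {X : V → Ω → EuclideanSpace ℝ (Fin N)} (hX : ∀ v, Measurable (X v))
    (hX_law : ∀ v, HasLaw (X v) (stdGaussian (EuclideanSpace ℝ (Fin N))) μ)
    (hX_indep : iIndepFun X μ) :
    HasLaw (fun ω => (√(sumVar w S))⁻¹ • partialSum w X S ω)
      (stdGaussian (EuclideanSpace ℝ (Fin N))) μ := by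
  have hm : Measurable (partialSum w X S) := by unfold partialSum; fun_prop
  refine ⟨by fun_prop, ?_⟩
  have : IsProbabilityMeasure (μ.map fun ω => (√(sumVar w S))⁻¹ • partialSum w X S ω) :=
    Measure.isProbabilityMeasure_map (by fun_prop)
  refine Measure.ext_of_charFun ?_
  ext s
  rw [charFun_map_smul_comp (by fun_prop), charFun_stdGaussian]
  have hind : iIndepFun (fun v ω => w v • X v ω) μ :=
    hX_indep.comp (fun v x => w v • x) fun v => by fun_prop
  unfold partialSum
  rw [(hind.restrict S).charFun_map_fun_finsetSum_eq_prod (fun v _ => by fun_prop),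
    Finset.prod_apply]
  simp_rw [charFun_map_smul_comp (hX _).aemeasurable, (hX_law _).map_eq, charFun_stdGaussian,
    ← Complex.exp_sum]
  congr 1
  have hS' : (√(sumVar w S)) ^ 2 = ∑ v ∈ S, w v ^ 2 := Real.sq_sqrt hS.le
  have hpos : 0 < ∑ v ∈ S, w v ^ 2 := hS
  have hterm : ∀ v, ‖w v • (√(sumVar w S))⁻¹ • s‖ ^ 2 =
      w v ^ 2 * ((∑ v ∈ S, w v ^ 2)⁻¹ * ‖s‖ ^ 2) := fun v => by
    rw [norm_smul, norm_smul, mul_pow, mul_pow, norm_inv, inv_pow, Real.norm_eq_abs,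
      Real.norm_eq_abs, sq_abs, sq_abs, hS']
  norm_cast
  simp_rw [hterm]
  rw [← Finset.sum_div, Finset.sum_neg_distrib, ← Finset.sum_mul, ← mul_assoc,
    mul_inv_cancel₀ hpos.ne', one_mul]

end Gaussian

lemma indepFun_prodMk_right_of_prodMk_left {Ω α β γ : Type*} [MeasurableSpace Ω]
    [MeasurableSpace α] [MeasurableSpace β] [MeasurableSpace γ] {μ : Measure Ω}
    [IsProbabilityMeasure μ] {A : Ω → α} {B : Ω → β} {C : Ω → γ} (hA : Measurable A)
    (hB : Measurable B) (hC : Measurable C) (hAB : IndepFun A B μ)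
    (hABC : IndepFun (fun ω => (A ω, B ω)) C μ) : IndepFun A (fun ω => (B ω, C ω)) μ := by
  have := Measure.isProbabilityMeasure_map (μ := μ) hA.aemeasurable
  have := Measure.isProbabilityMeasure_map (μ := μ) hB.aemeasurable
  have := Measure.isProbabilityMeasure_map (μ := μ) hC.aemeasurable
  have hBC : IndepFun B C μ := hABC.comp measurable_snd measurable_id
  rw [indepFun_iff_map_prod_eq_prod_map_map hA.aemeasurable (hB.prodMk hC).aemeasurable,
    hBC.map_prod_eq_prod_map_map hB.aemeasurable hC.aemeasurable,
    ← (measurePreserving_prodAssoc (μ.map A) (μ.map B) (μ.map C)).map_eq,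
    ← hAB.map_prod_eq_prod_map_map hA.aemeasurable hB.aemeasurable,
    ← hABC.map_prod_eq_prod_map_map (hA.prodMk hB).aemeasurable hC.aemeasurable,
    Measure.map_map (by fun_prop) (by fun_prop)]
  rfl

/-! ### The bound for one edge, and counting bits. -/

section CutSet

variable {V : Type*} {G : SimpleGraph V} {N : ℕ} {Ω : Type*}
  [MeasurableSpace Ω] {μ : Measure Ω} [IsProbabilityMeasure μ]
  {X : V → Ω → EuclideanSpace ℝ (Fin N)} {𝓤 : V → Type*} [∀ v, MeasurableSpace (𝓤 v)]
  {U : ∀ v, Ω → 𝓤 v}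

/-- The partial sum over `S` is independent of the observations outside `S` together with the
random data. -/
lemma indepFun_partialSum [Fintype V] [DecidableEq V] (w : V → ℝ) (S : Finset V) (hX : ∀ v, Measurable (X v))
    (hX_indep : iIndepFun X μ) (hU : ∀ v, Measurable (U v))
    (hXU : IndepFun (fun ω v => X v ω) (fun ω v => U v ω) μ) :
    IndepFun (partialSum w X S)
      (fun ω => ((fun v => if v ∈ S then 0 else X v ω : V → EuclideanSpace ℝ (Fin N)),
        fun v => U v ω)) μ := by
  have hsum : Measurable fun x : V → EuclideanSpace ℝ (Fin N) => ∑ j ∈ S, w j • x j := by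
    fun_prop
  have hout : Measurable fun (x : V → EuclideanSpace ℝ (Fin N)) v => if v ∈ S then 0 else x v := by
    refine measurable_pi_lambda _ fun v => ?_
    split_ifs <;> fun_prop
  have hXm : Measurable fun ω v => X v ω := measurable_pi_lambda _ hX
  refine indepFun_prodMk_right_of_prodMk_left (hsum.comp hXm) (hout.comp hXm)
    (measurable_pi_lambda _ hU) ?_ (hXU.comp (hsum.prodMk hout) measurable_id)
  have h := hX_indep.indepFun_finset S Sᶜ disjoint_compl_right hX
  have h1 : Measurable fun x : S → EuclideanSpace ℝ (Fin N) => ∑ j : S, w j • x j := by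
    fun_prop
  have h2 : Measurable fun (x : (Sᶜ : Finset V) → EuclideanSpace ℝ (Fin N)) v =>
      if hv : v ∈ S then 0 else x ⟨v, Finset.mem_compl.2 hv⟩ := by
    refine measurable_pi_lambda _ fun v => ?_
    split_ifs <;> fun_prop
  convert h.comp h1 h2 using 1
  · funext ω
    exact (Finset.sum_coe_sort S fun j => w j • X j ω).symm
  · funext ω v
    simp

variable [Fintype V] (hG : G.IsTree) (r : V) (w : V → ℝ)

/-- The number of bits sent from node `i` to its parent. -/
noncomputable def uplinkBits [DecidableEq V] (P : Scheme G N 𝓤) (i : V) : ℕ :=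
  ∑ t with P.sender t = i ∧ P.receiver t = parent hG r i, P.len t

/-- Each slot has a single sender, so it is counted for at most one node. -/
lemma sum_uplinkBits_le [DecidableEq V] (P : Scheme G N 𝓤) (s : Finset V) :
    ∑ i ∈ s, uplinkBits hG r P i ≤ ∑ t, P.len t := by
  calc ∑ i ∈ s, uplinkBits hG r P i
      ≤ ∑ i, ∑ t with P.sender t = i, P.len t :=
        (Finset.sum_le_sum fun i _ => Finset.sum_le_sum_of_subset fun t ht => by
          simp only [Finset.mem_filter] at ht ⊢
          exact ⟨ht.1, ht.2.1⟩).trans (Finset.sum_le_univ_sum_of_nonneg fun _ => zero_le)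
    _ = ∑ t, P.len t := Finset.sum_fiberwise _ _ _

/-- The cut-set bound for the edge between `i` and its parent. -/
lemma cutSet_bound [DecidableEq V] (hN : 0 < N) (hX : ∀ v, Measurable (X v))
    (hX_law : ∀ v, HasLaw (X v) (stdGaussian (EuclideanSpace ℝ (Fin N))) μ)
    (hX_indep : iIndepFun X μ) (hU : ∀ v, Measurable (U v))
    (hXU : IndepFun (fun ω v => X v ω) (fun ω v => U v ω) μ)
    (P : Scheme G N 𝓤) {i : V} (hi : i ≠ r) (hS : 0 < sumVar w (subtree hG r i)) :
    0 < distRx μ hG r w X U P i ∧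
      N / 2 * Real.log (sumVar w (subtree hG r i) / distRx μ hG r w X U P i) ≤
        uplinkBits hG r P i * Real.log 2 := by
  classical
  set S := subtree hG r i with hSdef
  set p := parent hG r i with hp
  set C : Fin P.T → Prop := fun t => P.sender t = i ∧ P.receiver t = p with hC
  have hCS : ∀ t, P.sender t ∈ S → P.receiver t ∉ S → C t := fun t h1 h2 =>
    eq_parent_of_adj_of_mem_subtree hG (P.adj t) h1 h2
  have hpS : p ∉ S := parent_notMem_subtree hG hi
  set σ := √(sumVar w S) with hσdef
  have hσ : 0 < σ := Real.sqrt_pos.2 hS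
  -- Doob–Dynkin: the conditional expectation is a measurable function of the parent's information.
  obtain ⟨h, hh, hest⟩ := StronglyMeasurable.exists_eq_measurable_comp
    (stronglyMeasurable_condExp : StronglyMeasurable[MeasurableSpace.comap
      (fun ω => P.info p (fun j => X j ω) (fun j => U j ω)) inferInstance]
        (mmseEstimate μ w X U P S p))
  -- Even the random data inside `S` count as side information; they are independent of the partial
  -- sum.
  set Z : Ω → (V → EuclideanSpace ℝ (Fin N)) × (∀ v, 𝓤 v) := fun ω =>
    (fun v => if v ∈ S then 0 else X v ω, fun v => U v ω) with hZdef
  have hZ : Measurable Z := by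
    refine Measurable.prodMk (measurable_pi_lambda _ fun v => ?_) (measurable_pi_lambda _ hU)
    split_ifs <;> fun_prop
  set B : Ω → ∀ t : {t // C t}, Fin (P.len t.1) → Bool := fun ω t =>
    P.message (fun j => X j ω) (fun j => U j ω) t.1 with hB
  set c : (∀ t : {t // C t}, Fin (P.len t.1) → Bool) →
      (V → EuclideanSpace ℝ (Fin N)) × (∀ v, 𝓤 v) → EuclideanSpace ℝ (Fin N) := fun b z =>
    h (P.infoGiven C p b z.1 z.2) with hc
  have hcm : ∀ b, Measurable (c b) := fun b =>
    hh.measurable.comp (P.measurable_infoGiven C p b)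
  have hcest : ∀ ω, c (B ω) (Z ω) = mmseEstimate μ w X U P S p ω := fun ω => by
    rw [mmseEstimate, hest, Function.comp_apply, hc]
    simp only
    rw [P.infoGiven_eq_info hCS (fun j => U j ω) (fun v hv => if_neg hv) hpS]
  have hYσ : ∀ ω, σ • σ⁻¹ • partialSum w X S ω = partialSum w X S ω := fun ω => by
    rw [smul_smul, mul_inv_cancel₀ hσ.ne', one_smul]
  have hA := hasLaw_inv_smul_sum hS hX hX_law hX_indep
  have hAZ : IndepFun (fun ω => σ⁻¹ • partialSum w X S ω) Z μ :=
    (indepFun_partialSum w S hX hX_indep hU hXU).comp (φ := fun y => σ⁻¹ • y)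
      (by fun_prop) measurable_id
  have hXL : ∀ v, MemLp (X v) 2 μ := fun v => by
    have h := memLp_id_stdGaussian (N := N)
    rw [← (hX_law v).map_eq] at h
    exact h.comp_of_map (hX_law v).aemeasurable
  have hYL : MemLp (partialSum w X S) 2 μ :=
    memLp_finsetSum _ fun j _ => (hXL j).const_smul (w j)
  have hint : Integrable
      (fun ω => ‖σ • σ⁻¹ • partialSum w X S ω - c (B ω) (Z ω)‖ ^ 2) μ := by
    simp_rw [hYσ, hcest]
    exact (hYL.sub (hYL.condExp one_le_two)).integrable_norm_pow two_ne_zero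
  have hD : distRx μ hG r w X U P i = (1 / N : ℝ) *
      ∫ ω, ‖σ • σ⁻¹ • partialSum w X S ω - c (B ω) (Z ω)‖ ^ 2 ∂μ := by
    simp_rw [hYσ, hcest]
    rfl
  have key := distortion_bound hN hA hZ hAZ hcm hσ hint hD
  refine ⟨key.1, ?_⟩
  have hcard : Real.log (Fintype.card (∀ t : {t // C t}, Fin (P.len t.1) → Bool)) =
      uplinkBits hG r P i * Real.log 2 := by
    have : Fintype.card (∀ t : {t // C t}, Fin (P.len t.1) → Bool) =
        2 ^ uplinkBits hG r P i := by
      simp only [Fintype.card_pi, Fintype.card_bool, Finset.prod_const, Finset.card_univ,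
        Fintype.card_fin]
      rw [Finset.prod_pow_eq_pow_sum, uplinkBits]
      congr 1
      exact (Finset.sum_subtype _ (by simp [hC, hp]) _).symm
    rw [this]
    push_cast
    rw [Real.log_pow]
  rw [← hcard, ← Real.sq_sqrt hS.le]
  exact key.2

end CutSet

end TreeAggregation

theorem theorem3
    {V : Type*} [Fintype V] [DecidableEq V] (G : SimpleGraph V) (hG : G.IsTree) (r : V)
    (w : V → ℝ) (N : ℕ) (hN : 0 < N)
    {Ω : Type*} [MeasurableSpace Ω] (μ : Measure Ω) [IsProbabilityMeasure μ]
    (X : V → Ω → EuclideanSpace ℝ (Fin N)) (hX : ∀ v, Measurable (X v))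
    (hX_law : ∀ v, HasLaw (X v) (stdGaussian (EuclideanSpace ℝ (Fin N))) μ)
    (hX_indep : iIndepFun X μ)
    (𝓤 : V → Type*) [∀ v, MeasurableSpace (𝓤 v)]
    (U : ∀ v, Ω → 𝓤 v) (hU : ∀ v, Measurable (U v))
    (hXU : IndepFun (fun ω v => X v ω) (fun ω v => U v ω) μ)
    (P : Scheme G N 𝓤) :
    (∀ i, i ≠ r → 0 < sumVar w (subtree hG r i) → 0 < distRx μ hG r w X U P i) ∧
    P.sumRate ≥ (1 / 2 : ℝ) * ∑ i ∈ Finset.univ.erase r,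
      Real.logb 2 (sumVar w (subtree hG r i) / distRx μ hG r w X U P i) := by
  refine ⟨fun i hi hS => (cutSet_bound hG r w hN hX hX_law hX_indep hU hXU P hi hS).1, ?_⟩
  have hN' : (0 : ℝ) < N := by exact_mod_cast hN
  have hlog2 : 0 < Real.log 2 := Real.log_pos one_lt_two
  have hbits : ∀ i ∈ Finset.univ.erase r,
      N / 2 * Real.logb 2 (sumVar w (subtree hG r i) / distRx μ hG r w X U P i) ≤
        uplinkBits hG r P i := by
    intro i hi
    have h0 : 0 ≤ sumVar w (subtree hG r i) := Finset.sum_nonneg fun _ _ => sq_nonneg _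
    -- At zero variance the term is `logb 2 0 = 0`, which matches the convention.
    rcases h0.eq_or_lt with h0 | hS
    · rw [← h0]
      simp
    · have h := (cutSet_bound hG r w hN hX hX_law hX_indep hU hXU P (Finset.ne_of_mem_erase hi)
        hS).2
      rwa [Real.logb, ← mul_div_assoc, div_le_iff₀ hlog2]
  have hsum := (Finset.sum_le_sum hbits).trans
    (by exact_mod_cast sum_uplinkBits_le hG r P (Finset.univ.erase r) :
      ∑ i ∈ Finset.univ.erase r, (uplinkBits hG r P i : ℝ) ≤ ∑ t, (P.len t : ℝ))
  rw [← Finset.mul_sum] at hsum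
  rw [ge_iff_le, Scheme.sumRate, le_div_iff₀ hN']
  linarith
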